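/- Let $\mathscr H$ be a complex Hilbert space. For $1<p<\infty$ let $\mathbb B_p(\mathscr H)$ be the Schatten class of all compact operators $T$ on $\mathscr H$ with $\|T\|_p=\big(\sum_j s_j(T)^p\big)^{1/p}<\infty$, where $s_1(T)\ge s_2(T)\ge\cdots$ are the singular values of $T$ (the square roots of the eigenvalues of $T^*T$, repeated according to multiplicity), and let $q=p/(p-1)$ be the conjugate exponent. Let $U=(u_{ij})$ be a subunitary complex $s\times t$ matrix, that is, a matrix with orthonormal columns: $U^*U=I_t$ (so $s\ge t$). Let $X_1,\dots,X_s,Y_1,\dots,Y_t\in\mathbb B_p(\mathscr H)$. (i) If $1<p\le 2$ and $X_i=\sum_{j=1}^t u_{ij}Y_j$ for $i=1,\dots,s$, then $$\sum_{i=1}^s\|X_i\|_p^q\le\Big(\max_{i,j}|u_{ij}|\Big)^{\frac qp-1}\Big(\sum_{j=1}^t\|Y_j\|_p^p\Big)^{\frac qp}.$$ (ii) If $2\le p<\infty$ and $X_i=\sum_{j=1}^t\overline{u_{ij}}\,Y_j$ for $i=1,\dots,s$, then $$\sum_{i=1}^s\|X_i\|_p^q\ge\Big(\max_{i,j}|u_{ij}|\Big)^{\frac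 qp-1}\Big(\sum_{j=1}^t\|Y_j\|_p^p\Big)^{\frac qp}.$$ -/

import Mathlib

open scoped ENNReal

noncomputable section

/-- The multiplicity of `σ > 0` as a singular value of a (compact) operator `T` on a Hilbert space,
i.e. the dimension of the eigenspace of `T* T` for the eigenvalue `σ ^ 2`. For compact `T` and
`σ > 0` this eigenspace is finite-dimensional. -/
def singularMultiplicity {H : Type*} [NormedAddCommGroup H] [InnerProductSpace ℂ H]
    [CompleteSpace H] (T : H →L[ℂ] H) (σ : ℝ) : ℕ :=
  Module.finrank ℂ
    (Module.End.eigenspace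
      ((ContinuousLinearMap.adjoint T ∘L T : H →L[ℂ] H) : H →ₗ[ℂ] H) ((σ : ℂ) ^ 2))

/-- The sum `∑ⱼ sⱼ(T) ^ p` over the nonzero singular values of a compact operator `T`, each
repeated according to its multiplicity. -/
def schattenSum {H : Type*} [NormedAddCommGroup H] [InnerProductSpace ℂ H]
    [CompleteSpace H] (p : ℝ) (T : H →L[ℂ] H) : ℝ≥0∞ :=
  ∑' σ : {σ : ℝ // 0 < σ},
    (singularMultiplicity T (σ : ℝ) : ℝ≥0∞) * ENNReal.ofReal ((σ : ℝ) ^ p)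

/-- The Schatten `p`-class: compact operators whose singular values are `p`-summable. -/
def MemSchatten {H : Type*} [NormedAddCommGroup H] [InnerProductSpace ℂ H]
    [CompleteSpace H] (p : ℝ) (T : H →L[ℂ] H) : Prop :=
  IsCompactOperator T ∧ schattenSum p T ≠ ∞

/-- The Schatten `p`-norm `(∑ⱼ sⱼ(T) ^ p) ^ (1 / p)` of an operator of the Schatten `p`-class. -/
def schattenNorm {H : Type*} [NormedAddCommGroup H] [InnerProductSpace ℂ H]
    [CompleteSpace H] (p : ℝ) (T : H →L[ℂ] H) : ℝ :=
  (schattenSum p T).toReal ^ (1 / p)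

/-- An `s × t` matrix is subunitary if its columns are orthonormal (so that `t ≤ s`). -/
def IsSubunitary {s t : ℕ} (U : Matrix (Fin s) (Fin t) ℂ) : Prop :=
  U.conjTranspose * U = 1

/-- The largest modulus of an entry of a matrix. -/
def maxEntry {s t : ℕ} (U : Matrix (Fin s) (Fin t) ℂ) : ℝ :=
  ⨆ k : Fin s × Fin t, ‖U k.1 k.2‖

end

/-! Both inequalities come from one interpolated bilinear estimate. Put `M = max |u_ij|` and `Φ(A,
B) = ∑ u_ij tr(A_j B_i)`. Trace/operator-norm duality gives `|Φ| ≤ M ∑ ‖A_j‖_1 ∑ ‖B_i‖_∞`; since `U`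
has orthonormal columns, Cauchy–Schwarz bounds `|Φ|` by the product of the Hilbert–Schmidt norms of
the two families. For conjugate `r ≥ 2` and `r'`, the three lines theorem at `θ = 2/r` yields `|Φ| ≤
M^(1-2/r) (∑ ‖A_j‖_{r'}^{r'})^(1/r') (∑ ‖B_i‖_r^{r'})^(1/r')`. This is
`norm_pairing_le_of_holderConjugate`.

For (i) take `r = q`, `A = Y` and `B_i` the norming functional of `X_i`, scaled so that `Φ` equals
the sum to be bounded. For (ii) take `r = p`, `B = X` and `A_j` dual to `Y_j`, after inverting the
relation to `Y_j = ∑ u_ij X_i` by `U* U = 1`.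

Singular value expansions turn traces into double sums of inner products. Working with finite
truncations keeps every quantity finite, so that powers of it can be cancelled; limits restore the
full operators. -/

/-! ### Singular value decomposition -/

open Module End in
/-- Singular value decomposition of a compact operator, indexed so that the Schatten sums are the
power sums of the singular values. -/
theorem IsCompactOperator.exists_singularValueDecomposition {H : Type*} [NormedAddCommGroup H]
    [InnerProductSpace ℂ H] [CompleteSpace H] {T : H →L[ℂ] H} (hT : IsCompactOperator T) :
    ∃ (ι : Type) (σ : ι → ℝ) (e f : ι → H), (∀ k, 0 < σ k) ∧ Orthonormal ℂ e ∧ Orthonormal ℂ f ∧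
      (∀ x, HasSum (fun k => ((σ k : ℂ) * inner ℂ (e k) x) • f k) (T x)) ∧
      ∀ p : ℝ, schattenSum p T = ∑' k, ENNReal.ofReal (σ k ^ p) := by
  set S : H →L[ℂ] H := ContinuousLinearMap.adjoint T ∘L T with hS
  have hSc : IsCompactOperator S :=
    hT.clm_comp (ContinuousLinearMap.adjoint T)
  have hSin : ∀ x y, inner ℂ x (S y) = inner ℂ (T x) (T y) := fun x y => by
    simp [hS, ContinuousLinearMap.adjoint_inner_right]
  have hSin' : ∀ x y, inner ℂ (S x) y = inner ℂ (T x) (T y) := fun x y => by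
    simp [hS, ContinuousLinearMap.adjoint_inner_left]
  have hSs : (S : H →ₗ[ℂ] H).IsSymmetric := fun x y => by
    simp [hSin, hSin']
  have hfd : ∀ σ : {σ : ℝ // 0 < σ},
      FiniteDimensional ℂ (eigenspace (S : H →ₗ[ℂ] H) (((σ : ℝ) : ℂ) ^ 2)) := fun σ =>
    ContinuousLinearMap.finite_dimensional_eigenspace hSc _
      (pow_ne_zero 2 (Complex.ofReal_ne_zero.2 σ.2.ne'))
  have hinj : Function.Injective (fun σ : {σ : ℝ // 0 < σ} => ((σ : ℝ) : ℂ) ^ 2) := by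
    intro a b hab
    have h : (a : ℝ) ^ 2 = (b : ℝ) ^ 2 := by
      simp only at hab
      exact_mod_cast hab
    exact Subtype.ext ((pow_left_inj₀ a.2.le b.2.le two_ne_zero).1 h)
  have hfam := hSs.orthogonalFamily_eigenspaces.comp hinj
  let b := fun σ : {σ : ℝ // 0 < σ} =>
    stdOrthonormalBasis ℂ (eigenspace (S : H →ₗ[ℂ] H) (((σ : ℝ) : ℂ) ^ 2))
  let ι := Σ σ : {σ : ℝ // 0 < σ},
    Fin (finrank ℂ (eigenspace (S : H →ₗ[ℂ] H) (((σ : ℝ) : ℂ) ^ 2)))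
  let e : ι → H := fun k => (b k.1 k.2 : H)
  have he : Orthonormal ℂ e :=
    hfam.orthonormal_sigma_orthonormal (fun σ => (b σ).orthonormal)
  let s : ι → ℝ := fun k => k.1
  have hs : ∀ k, 0 < s k := fun k => k.1.2
  have hs0 : ∀ k, (s k : ℂ) ≠ 0 := fun k => Complex.ofReal_ne_zero.2 (hs k).ne'
  have hSe : ∀ k, S (e k) = ((s k : ℂ) ^ 2) • e k := fun k => mem_eigenspace_iff.1 (b k.1 k.2).2
  let f : ι → H := fun k => (s k : ℂ)⁻¹ • T (e k)
  have hTe : ∀ k, T (e k) = (s k : ℂ) • f k := fun k => by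
    simp [f, smul_smul, hs0 k]
  have hf : Orthonormal ℂ f := by
    classical
    rw [orthonormal_iff_ite] at he ⊢
    intro k l
    simp only [f, inner_smul_left, inner_smul_right, ← hSin, hSe, he]
    split_ifs with h
    · subst h
      simp only [map_inv₀, Complex.conj_ofReal]
      field_simp [hs0 k]
    · simp
  refine ⟨ι, s, e, f, hs, he, hf, fun x => ?_, fun p => ?_⟩
  · have hsum : Summable fun k => inner ℂ (e k) x • e k := by
      have := (he.orthogonalFamily.summable_iff_norm_sq_summable
        (fun k => inner ℂ (e k) x)).2 (he.inner_products_summable x)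
      simpa using this
    obtain ⟨y, hy⟩ := hsum
    have hr : ∀ k, inner ℂ (e k) (x - y) = 0 := fun k => by
      have h1 := hy.mapL (innerSL ℂ (e k))
      have h2 : HasSum (fun l => (innerSL ℂ (e k)) (inner ℂ (e l) x • e l)) (inner ℂ (e k) x) := by
        have := hasSum_single (f := fun l => (innerSL ℂ (e k)) (inner ℂ (e l) x • e l)) k
          (fun l hl => by simp [he.inner_eq_zero hl.symm])
        simpa [inner_smul_right, he.norm_eq_one] using this
      have h3 : inner ℂ (e k) y = inner ℂ (e k) x := h1.unique h2
      rw [inner_sub_right, h3, sub_self]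
    -- By the spectral theorem the eigenspaces of `S` have trivial common orthogonal complement, so
    -- it suffices that `S (x - y)` is orthogonal to each. For `μ ≠ 0` the eigenspace is spanned by
    -- some of the `e k`, to which `x - y` is orthogonal.
    have hSr : S (x - y) = 0 := by
      rw [← Submodule.mem_bot ℂ,
        ← ContinuousLinearMap.orthogonalComplement_iSup_eigenspaces_eq_bot hSc hSs,
        ← Submodule.iInf_orthogonal, Submodule.mem_iInf]
      intro μ w hw
      have hSw : S w = μ • w := mem_eigenspace_iff.1 hw
      have key : inner ℂ w (S (x - y)) = (starRingEnd ℂ) μ * inner ℂ w (x - y) := by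
        rw [hSin, ← hSin', hSw, inner_smul_left]
      rw [key]
      by_cases hμ : μ = 0
      · simp [hμ]
      by_cases hw0 : w = 0
      · simp [hw0]
      -- Hence a nonzero eigenvalue is the square of a positive real, and so belongs to the index
      -- set.
      have hval : μ * ((‖w‖ ^ 2 : ℝ) : ℂ) = ((‖T w‖ ^ 2 : ℝ) : ℂ) := by
        have := hSin w w
        rw [hSw, inner_smul_right, inner_self_eq_norm_sq_to_K, inner_self_eq_norm_sq_to_K] at this
        push_cast
        exact this
      have hw2 : ‖w‖ ≠ 0 := norm_ne_zero_iff.2 hw0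
      have hμv : μ = ((‖T w‖ / ‖w‖ : ℝ) : ℂ) ^ 2 := by
        have hw3 : ((‖w‖ : ℝ) : ℂ) ≠ 0 := Complex.ofReal_ne_zero.2 hw2
        push_cast at hval ⊢
        field_simp
        exact hval
      have hpos : 0 < ‖T w‖ / ‖w‖ := by
        refine lt_of_le_of_ne (by positivity) fun h => hμ ?_
        rw [hμv, ← h]; simp
      obtain ⟨σ, hσ⟩ : ∃ σ : {σ : ℝ // 0 < σ}, ((σ : ℝ) : ℂ) ^ 2 = μ := ⟨⟨_, hpos⟩, hμv.symm⟩
      subst hσ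
      have hexp := (b σ).sum_repr' ⟨w, hw⟩
      have hexp' : w = ∑ n, inner ℂ (b σ n) (⟨w, hw⟩ : eigenspace (S : H →ₗ[ℂ] H) _) • e ⟨σ, n⟩ := by
        have := congrArg Subtype.val hexp
        simpa [e] using this.symm
      have : inner ℂ w (x - y) = 0 := by
        rw [hexp', sum_inner]
        exact Finset.sum_eq_zero fun n _ => by rw [inner_smul_left, hr, mul_zero]
      rw [this, mul_zero]
    have hTr : T (x - y) = 0 := by
      rw [← inner_self_eq_zero (𝕜 := ℂ), ← hSin, hSr, inner_zero_right]
    have hTxy : T x = T y := by rwa [map_sub, sub_eq_zero] at hTr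
    rw [hTxy]
    have hterm : (fun k => ((s k : ℂ) * inner ℂ (e k) x) • f k) =
        fun k => T (inner ℂ (e k) x • e k) := by
      funext k
      rw [mul_comm, mul_smul, map_smul, hTe]
    rw [hterm]
    exact hy.mapL T
  · refine Eq.trans ?_ (ENNReal.tsum_sigma fun (σ : {σ : ℝ // 0 < σ})
      (_ : Fin (finrank ℂ (eigenspace (S : H →ₗ[ℂ] H) (((σ : ℝ) : ℂ) ^ 2)))) =>
        ENNReal.ofReal ((σ : ℝ) ^ p)).symm
    refine tsum_congr fun σ => ?_
    simp only [tsum_fintype, Finset.sum_const, Finset.card_univ, Fintype.card_fin, nsmul_eq_mul]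
    rfl

/-! ### The two endpoint estimates -/

section Pairing

variable {H : Type*} [NormedAddCommGroup H] [InnerProductSpace ℂ H]

/-- The pairing of `∑ₖ αₖ |fₖ⟩⟨eₖ|` and `∑ₗ βₗ |hₗ⟩⟨gₗ|` is bounded by the trace norm of the first
and the operator norm of the second. -/
theorem norm_pairing_le_sum_mul {κ ι : Type*} {e f : κ → H} {g h : ι → H}
    (he : Orthonormal ℂ e) (hf : Orthonormal ℂ f) (hg : Orthonormal ℂ g) (hh : Orthonormal ℂ h)
    (K : Finset κ) (L : Finset ι) (α : κ → ℂ) (β : ι → ℂ) {R : ℝ} (hR : 0 ≤ R)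
    (hβ : ∀ l ∈ L, ‖β l‖ ≤ R) :
    ‖∑ k ∈ K, ∑ l ∈ L, α k * β l * (inner ℂ (e k) (h l) * inner ℂ (g l) (f k))‖ ≤
      (∑ k ∈ K, ‖α k‖) * R := by
  rw [Finset.sum_mul]
  refine norm_sum_le_of_le _ fun k _ => ?_
  simp only [mul_assoc, ← Finset.mul_sum, norm_mul]
  refine mul_le_mul_of_nonneg_left ?_ (norm_nonneg _)
  -- Cauchy–Schwarz, then Bessel for each of `h` and `g`.
  have hcs : ∑ l ∈ L, ‖inner ℂ (e k) (h l)‖ * ‖inner ℂ (g l) (f k)‖ ≤ 1 := by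
    refine (Real.sum_mul_le_sqrt_mul_sqrt _ _ _).trans ?_
    have h1 := hh.sum_inner_products_le (e k) (s := L)
    have h2 := hg.sum_inner_products_le (f k) (s := L)
    simp only [norm_inner_symm _ (e k), he.norm_eq_one, hf.norm_eq_one, one_pow] at h1 h2
    exact mul_le_one₀ (Real.sqrt_le_one.2 h1) (Real.sqrt_nonneg _) (Real.sqrt_le_one.2 h2)
  calc ‖∑ l ∈ L, β l * (inner ℂ (e k) (h l) * inner ℂ (g l) (f k))‖
      ≤ ∑ l ∈ L, R * (‖inner ℂ (e k) (h l)‖ * ‖inner ℂ (g l) (f k)‖) := by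
        refine norm_sum_le_of_le _ fun l hl => ?_
        rw [norm_mul, norm_mul]
        exact mul_le_mul_of_nonneg_right (hβ l hl) (by positivity)
    _ ≤ R := by
        rw [← Finset.mul_sum]
        exact mul_le_of_le_one_right hR hcs

/-- A matrix with orthonormal columns induces a contraction `(vᵢ) ↦ (∑ᵢ conj (uᵢⱼ) vᵢ)` between
Hilbert space powers. -/
theorem sum_norm_sq_sum_conj_smul_le {I J : Type*} [Fintype I] [Fintype J] [DecidableEq J]
    {U : Matrix I J ℂ} (hU : U.conjTranspose * U = 1) (v : I → H) :
    ∑ j, ‖∑ i, (starRingEnd ℂ) (U i j) • v i‖ ^ 2 ≤ ∑ i, ‖v i‖ ^ 2 := by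
  set y : J → H := fun j => ∑ i, (starRingEnd ℂ) (U i j) • v i with hy
  have hUU : ∀ j j', ∑ i, (starRingEnd ℂ) (U i j) * U i j' = if j = j' then 1 else 0 := fun j j' => by
    simpa [Matrix.mul_apply, Matrix.one_apply] using congrFun (congrFun hU j) j'
  have hyv : ∀ j w, inner ℂ (y j) w = ∑ i, U i j * inner ℂ (v i) w := fun j w => by
    simp [hy, mul_comm]
  have h1 : ∑ i, inner ℂ (v i) (∑ j, U i j • y j) = ∑ j, inner ℂ (y j) (y j) := by
    simp only [inner_sum, inner_smul_right]
    rw [Finset.sum_comm]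
    refine Finset.sum_congr rfl fun j _ => ?_
    rw [hyv]
  have h2 : ∑ i, inner ℂ (∑ j, U i j • y j) (∑ j, U i j • y j) = ∑ j, inner ℂ (y j) (y j) := by
    simp only [sum_inner, inner_sum, inner_smul_left, inner_smul_right]
    rw [Finset.sum_comm]
    refine Finset.sum_congr rfl fun j _ => ?_
    simp only [Finset.mul_sum]
    rw [Finset.sum_comm]
    have : ∀ j', ∑ i, U i j * ((starRingEnd ℂ) (U i j') * inner ℂ (y j') (y j)) =
        (if j' = j then 1 else 0) * inner ℂ (y j') (y j) := fun j' => by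
      rw [← hUU, Finset.sum_mul]
      exact Finset.sum_congr rfl fun i _ => by ring
    simp only [this, ite_mul, one_mul, zero_mul, Finset.sum_ite_eq', Finset.mem_univ, if_true]
  -- With `y = U* v`, both `⟨v, U y⟩` and `‖U y‖²` equal `‖y‖²`, so this square is `‖v‖² - ‖y‖²`.
  have h3 : (0 : ℝ) ≤ ∑ i, ‖v i - ∑ j, U i j • y j‖ ^ 2 := by positivity
  have h4 : ∑ i, ‖v i - ∑ j, U i j • y j‖ ^ 2 = ∑ i, ‖v i‖ ^ 2 - ∑ j, ‖y j‖ ^ 2 := by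
    simp only [@norm_sub_sq ℂ, Finset.sum_add_distrib, Finset.sum_sub_distrib, ← Finset.mul_sum]
    have h1' := congrArg Complex.re h1
    have h2' := congrArg Complex.re h2
    simp only [Complex.re_sum] at h1' h2'
    simp only [@InnerProductSpace.norm_sq_eq_re_inner ℂ, RCLike.re_eq_complex_re] at *
    rw [h1', h2']; ring
  linarith

/-- The pairing of two families of finite rank operators, twisted by a matrix with orthonormal
columns, is bounded by the product of the Hilbert–Schmidt norms. -/
theorem norm_pairing_sq_le {I J : Type*} [Fintype I] [Fintype J] [DecidableEq J]
    {U : Matrix I J ℂ} (hU : U.conjTranspose * U = 1) {κ : J → Type*} {ι : I → Type*}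
    {e f : ∀ j, κ j → H} {g h : ∀ i, ι i → H}
    (he : ∀ j, Orthonormal ℂ (e j)) (hf : ∀ j, Orthonormal ℂ (f j))
    (hg : ∀ i, Orthonormal ℂ (g i)) (hh : ∀ i, Orthonormal ℂ (h i))
    (K : ∀ j, Finset (κ j)) (L : ∀ i, Finset (ι i)) (α : ∀ j, κ j → ℂ) (β : ∀ i, ι i → ℂ) :
    ‖∑ j, ∑ i, U i j * ∑ k ∈ K j, ∑ l ∈ L i,
        α j k * β i l * (inner ℂ (e j k) (h i l) * inner ℂ (g i l) (f j k))‖ ^ 2 ≤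
      (∑ j, ∑ k ∈ K j, ‖α j k‖ ^ 2) * ∑ i, ∑ l ∈ L i, ‖β i l‖ ^ 2 := by
  -- `v j k = ∑ᵢ uᵢⱼ Bᵢ f_jk`, where `Bᵢ = ∑ₗ βᵢₗ |hᵢₗ⟩⟨gᵢₗ|`.
  let v : ∀ j, κ j → H := fun j k => ∑ i, ∑ l ∈ L i, (U i j * β i l * inner ℂ (g i l) (f j k)) • h i l
  have h1 : ∑ j, ∑ i, U i j * ∑ k ∈ K j, ∑ l ∈ L i,
        α j k * β i l * (inner ℂ (e j k) (h i l) * inner ℂ (g i l) (f j k)) =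
      ∑ j, ∑ k ∈ K j, α j k * inner ℂ (e j k) (v j k) := by
    refine Finset.sum_congr rfl fun j _ => ?_
    simp only [v, inner_sum, inner_smul_right, Finset.mul_sum]
    rw [Finset.sum_comm]
    refine Finset.sum_congr rfl fun k _ => Finset.sum_congr rfl fun i _ =>
      Finset.sum_congr rfl fun l _ => by ring
  have h2 : ‖∑ j, ∑ k ∈ K j, α j k * inner ℂ (e j k) (v j k)‖ ^ 2 ≤
      (∑ j, ∑ k ∈ K j, ‖α j k‖ ^ 2) * ∑ j, ∑ k ∈ K j, ‖v j k‖ ^ 2 := by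
    have : ∀ F : (∀ j, κ j → ℝ), ∑ j, ∑ k ∈ K j, F j k =
      ∑ x ∈ Finset.univ.sigma K, F x.1 x.2 := fun F => Finset.sum_sigma' _ _ _
    rw [this (fun j k => ‖α j k‖ ^ 2), this (fun j k => ‖v j k‖ ^ 2)]
    refine le_trans ?_ (Finset.sum_mul_sq_le_sq_mul_sq _ _ _)
    gcongr
    rw [Finset.sum_sigma']
    refine norm_sum_le_of_le _ fun x _ => ?_
    rw [norm_mul]
    gcongr
    simpa [(he x.1).norm_eq_one] using norm_inner_le_norm (𝕜 := ℂ) (e x.1 x.2) (v x.1 x.2)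
  rw [h1]
  refine h2.trans (mul_le_mul_of_nonneg_left ?_ (by positivity))
  classical
  -- A finite-dimensional space containing every `v j k`, so that Parseval holds with a finite
  -- basis.
  let V : Submodule ℂ H := Submodule.span ℂ
    ((Finset.univ.sigma L).image fun x : (Σ i, ι i) => h x.1 x.2 : Finset H)
  have hV : FiniteDimensional ℂ V := FiniteDimensional.span_finset ℂ _
  have hvV : ∀ j k, v j k ∈ V := fun j k =>
    V.sum_mem fun i _ => V.sum_mem fun l hl => V.smul_mem _ <| Submodule.subset_span <| by
      simp only [Finset.coe_image, Set.mem_image]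
      exact ⟨⟨i, l⟩, by simpa using hl, rfl⟩
  let b := stdOrthonormalBasis ℂ V
  have hb : Orthonormal ℂ (fun m => (b m : H)) := b.orthonormal.comp_linearIsometry V.subtypeₗᵢ
  -- `d m i = Bᵢ* b_m`. Moving to adjoints exposes `f` to Bessel and `U*` to the contraction
  -- estimate.
  let d := fun m i => ∑ l ∈ L i, (starRingEnd ℂ) (β i l * inner ℂ (b m : H) (h i l)) • g i l
  have hv : ∀ j k, ‖v j k‖ ^ 2 =
      ∑ m, ‖inner ℂ (∑ i, (starRingEnd ℂ) (U i j) • d m i) (f j k)‖ ^ 2 := fun j k => by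
    have h3 := b.sum_sq_norm_inner_right ⟨v j k, hvV j k⟩
    simp only [Submodule.coe_norm, Submodule.coe_inner] at h3
    rw [← h3]
    refine Finset.sum_congr rfl fun m _ => ?_
    congr 2
    simp only [v, d, inner_sum, sum_inner, inner_smul_left, inner_smul_right, Complex.conj_conj,
      Finset.mul_sum]
    exact Finset.sum_congr rfl fun i _ => Finset.sum_congr rfl fun l _ => by ring
  have hd : ∀ m i, ‖d m i‖ ^ 2 = ∑ l ∈ L i, ‖β i l‖ ^ 2 * ‖inner ℂ (b m : H) (h i l)‖ ^ 2 :=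
    fun m i => by
      rw [@InnerProductSpace.norm_sq_eq_re_inner ℂ, (hg i).inner_sum]
      simp only [map_sum]
      refine Finset.sum_congr rfl fun l _ => ?_
      rw [Complex.conj_conj, Complex.mul_conj, ← mul_pow, ← norm_mul]
      rw [Complex.normSq_eq_norm_sq]
      exact Complex.ofReal_re _
  calc ∑ j, ∑ k ∈ K j, ‖v j k‖ ^ 2
      = ∑ m, ∑ j, ∑ k ∈ K j, ‖inner ℂ (f j k) (∑ i, (starRingEnd ℂ) (U i j) • d m i)‖ ^ 2 := by
        simp only [hv]
        rw [Finset.sum_comm]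
        refine Finset.sum_congr rfl fun j _ => ?_
        rw [Finset.sum_comm]
        exact Finset.sum_congr rfl fun k _ => Finset.sum_congr rfl fun m _ => by
          rw [norm_inner_symm]
    _ ≤ ∑ m, ∑ j, ‖∑ i, (starRingEnd ℂ) (U i j) • d m i‖ ^ 2 :=
        Finset.sum_le_sum fun m _ => Finset.sum_le_sum fun j _ => (hf j).sum_inner_products_le _
    _ ≤ ∑ m, ∑ i, ‖d m i‖ ^ 2 :=
        Finset.sum_le_sum fun m _ => sum_norm_sq_sum_conj_smul_le hU _
    _ = ∑ i, ∑ l ∈ L i, ‖β i l‖ ^ 2 * ∑ m, ‖inner ℂ (b m : H) (h i l)‖ ^ 2 := by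
        simp only [hd]
        rw [Finset.sum_comm]
        refine Finset.sum_congr rfl fun i _ => ?_
        rw [Finset.sum_comm]
        simp only [Finset.mul_sum]
    _ ≤ ∑ i, ∑ l ∈ L i, ‖β i l‖ ^ 2 := by
        refine Finset.sum_le_sum fun i _ => Finset.sum_le_sum fun l _ => ?_
        refine mul_le_of_le_one_right (by positivity) ?_
        simpa [(hh i).norm_eq_one] using hb.sum_inner_products_le (h i l) (s := Finset.univ)

end Pairing

/-! ### Interpolation by the three lines theorem -/

section Interpolation

variable {H : Type*} [NormedAddCommGroup H] [InnerProductSpace ℂ H]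

/-- The bilinear form of the Riesz–Thorin interpolation between the trace/operator norm pairing and
the Hilbert–Schmidt pairing, for families of finite rank operators. -/
theorem norm_pairing_le_of_holderConjugate {I J : Type*} [Fintype I] [Fintype J] [DecidableEq J]
    {U : Matrix I J ℂ} (hU : U.conjTranspose * U = 1) {M : ℝ} (hM : 0 ≤ M)
    (hUM : ∀ i j, ‖U i j‖ ≤ M) {p q : ℝ} (hpq : p.HolderConjugate q) (hp : 2 ≤ p)
    {κ : J → Type*} {ι : I → Type*} {e f : ∀ j, κ j → H} {g h : ∀ i, ι i → H}
    (he : ∀ j, Orthonormal ℂ (e j)) (hf : ∀ j, Orthonormal ℂ (f j))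
    (hg : ∀ i, Orthonormal ℂ (g i)) (hh : ∀ i, Orthonormal ℂ (h i))
    (K : ∀ j, Finset (κ j)) (L : ∀ i, Finset (ι i)) {a : ∀ j, κ j → ℝ} {b : ∀ i, ι i → ℝ}
    (ha : ∀ j, ∀ k ∈ K j, 0 < a j k) (hb : ∀ i, ∀ l ∈ L i, 0 < b i l) :
    ‖∑ j, ∑ i, U i j * ∑ k ∈ K j, ∑ l ∈ L i,
        (a j k : ℂ) * (b i l : ℂ) * (inner ℂ (e j k) (h i l) * inner ℂ (g i l) (f j k))‖ ≤
      M ^ (1 - 2 / p) * ((∑ j, ∑ k ∈ K j, a j k ^ q) ^ (1 / q) *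
        (∑ i, (∑ l ∈ L i, b i l ^ p) ^ (q / p)) ^ (1 / q)) := by
  have hp0 : 0 < p := hpq.pos
  have hq0 : 0 < q := hpq.symm.pos
  have hinv : p⁻¹ + q⁻¹ = 1 := hpq.inv_add_inv_eq_one
  set S : I → ℝ := fun i => ∑ l ∈ L i, b i l ^ p with hS
  have hSpos : ∀ i, ∀ l ∈ L i, 0 < S i := fun i l hl =>
    Finset.sum_pos (fun l hl => Real.rpow_pos_of_pos (hb i l hl) _) ⟨l, hl⟩
  have hS0 : ∀ i, 0 ≤ S i := fun i =>
    Finset.sum_nonneg fun l hl => (Real.rpow_pos_of_pos (hb i l hl) _).le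
  set A : ℝ := ∑ j, ∑ k ∈ K j, a j k ^ q with hA
  set N : ℝ := ∑ i, S i ^ (q / p) with hN
  have hA0 : 0 ≤ A := Finset.sum_nonneg fun j _ => Finset.sum_nonneg fun k hk =>
    (Real.rpow_pos_of_pos (ha j k hk) _).le
  have hN0 : 0 ≤ N := Finset.sum_nonneg fun i _ => Real.rpow_nonneg (hS0 i) _
  -- Analytic families passing through `a`, `b` at `z = 2/p`. On `Re z = 0` the moduli are `a^q` and
  -- `S^(q/p)`, constant in `l`; on `Re z = 1` their squares are `a^q` and `S^(q/p - 1) b^p`, which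
  -- sum to `A` and `N`.
  let α : ℂ → ∀ j, κ j → ℂ := fun z j k => Complex.exp (q * (1 - z / 2) * Real.log (a j k))
  let β : ℂ → ∀ i, ι i → ℂ := fun z i l => Complex.exp ((q / p) * (1 - z / 2) * Real.log (S i) +
    (p * z / 2) * (Real.log (b i l) - Real.log (S i) / p))
  have hα : ∀ z j k, ‖α z j k‖ = Real.exp (q * (1 - z.re / 2) * Real.log (a j k)) := by
    intro z j k
    simp only [α, Complex.norm_exp]
    congr 1
    rw [Complex.re_mul_ofReal, Complex.re_ofReal_mul]
    simp
  have hβ : ∀ z i l, ‖β z i l‖ = Real.exp ((q / p) * (1 - z.re / 2) * Real.log (S i) +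
      (p * z.re / 2) * (Real.log (b i l) - Real.log (S i) / p)) := by
    intro z i l
    simp only [β, Complex.norm_exp]
    congr 1
    have h1 : (q / p : ℂ) * (1 - z / 2) * Real.log (S i) +
        (p * z / 2) * (Real.log (b i l) - Real.log (S i) / p) =
        ((q / p * Real.log (S i) : ℝ) : ℂ) + ((-(q / p / 2 * Real.log (S i)) +
          p / 2 * (Real.log (b i l) - Real.log (S i) / p) : ℝ) : ℂ) * z := by
      push_cast; ring
    rw [h1, Complex.add_re, Complex.ofReal_re, Complex.re_ofReal_mul]
    ring
  let F : ℂ → ℂ := fun z => ∑ j, ∑ i, U i j * ∑ k ∈ K j, ∑ l ∈ L i,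
    α z j k * β z i l * (inner ℂ (e j k) (h i l) * inner ℂ (g i l) (f j k))
  have hFd : Differentiable ℂ F := by
    simp only [F, α, β]
    fun_prop
  -- The moduli of `α` and `β` depend only on `Re z ∈ [0, 1]`.
  have hFb : BddAbove ((norm ∘ F) '' Complex.HadamardThreeLines.verticalClosedStrip 0 1) := by
    refine ⟨∑ j, ∑ i, ‖U i j‖ * ∑ k ∈ K j, ∑ l ∈ L i,
      Real.exp (q * |Real.log (a j k)|) * Real.exp (q / p * |Real.log (S i)| +
        p * |Real.log (b i l) - Real.log (S i) / p|) *
        ‖inner ℂ (e j k) (h i l) * inner ℂ (g i l) (f j k)‖, ?_⟩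
    rintro _ ⟨z, hz, rfl⟩
    obtain ⟨hz0, hz1⟩ : 0 ≤ z.re ∧ z.re ≤ 1 := hz
    refine norm_sum_le_of_le _ fun j _ => norm_sum_le_of_le _ fun i _ => ?_
    rw [norm_mul]
    refine mul_le_mul_of_nonneg_left ?_ (norm_nonneg _)
    refine norm_sum_le_of_le _ fun k _ => norm_sum_le_of_le _ fun l _ => ?_
    rw [norm_mul, norm_mul, hα, hβ]
    have hmul : ∀ c d x : ℝ, 0 ≤ c → c ≤ d → c * x ≤ d * |x| := fun c d x h0 h1 =>
      (mul_le_mul_of_nonneg_left (le_abs_self x) h0).trans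
        (mul_le_mul_of_nonneg_right h1 (abs_nonneg x))
    have hqp : 0 < q / p := div_pos hq0 hp0
    gcongr ?_ * ?_ * _
    · exact Real.exp_le_exp.2 (hmul _ _ _ (mul_nonneg hq0.le (by linarith)) (by nlinarith))
    · refine Real.exp_le_exp.2 (add_le_add
        (hmul _ _ _ (mul_nonneg hqp.le (by linarith)) (by nlinarith))
        (hmul _ _ _ (by positivity) (by nlinarith)))
  have hF0 : ∀ z ∈ Complex.re ⁻¹' {(0 : ℝ)}, ‖F z‖ ≤ M * (A * N) := by
    intro z hz
    have hz : z.re = 0 := hz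
    calc ‖F z‖ ≤ ∑ j, ∑ i, M * ((∑ k ∈ K j, a j k ^ q) * S i ^ (q / p)) := by
          refine norm_sum_le_of_le _ fun j _ => norm_sum_le_of_le _ fun i _ => ?_
          rw [norm_mul]
          refine mul_le_mul (hUM i j) ?_ (norm_nonneg _) hM
          refine (norm_pairing_le_sum_mul (he j) (hf j) (hg i) (hh i) (K j) (L i) (α z j) (β z i)
            (Real.rpow_nonneg (hS0 i) (q / p)) fun l hl => ?_).trans (le_of_eq ?_)
          · rw [hβ, hz, Real.rpow_def_of_pos (hSpos i l hl)]
            exact le_of_eq (congrArg _ (by ring))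
          · congr 1
            refine Finset.sum_congr rfl fun k hk => ?_
            rw [hα, hz, Real.rpow_def_of_pos (ha j k hk)]
            exact congrArg _ (by ring)
      _ = M * (A * N) := by
          rw [hA, hN, Finset.sum_mul_sum]
          simp only [Finset.mul_sum]
  have hF1 : ∀ z ∈ Complex.re ⁻¹' {(1 : ℝ)}, ‖F z‖ ≤ (A * N) ^ (1 / 2 : ℝ) := by
    intro z hz
    have hz : z.re = 1 := hz
    rw [← Real.sqrt_eq_rpow]
    refine Real.le_sqrt_of_sq_le ((norm_pairing_sq_le hU he hf hg hh K L (α z) (β z)).trans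
      (le_of_eq ?_))
    congr 1
    · refine Finset.sum_congr rfl fun j _ => Finset.sum_congr rfl fun k hk => ?_
      rw [hα, hz, Real.rpow_def_of_pos (ha j k hk), ← Real.exp_nat_mul]
      exact congrArg _ (by push_cast; ring)
    · refine Finset.sum_congr rfl fun i _ => ?_
      rcases (L i).eq_empty_or_nonempty with hL | ⟨l₀, hl₀⟩
      -- An empty truncation has `S i = 0`; it contributes `0` on both sides because `q / p ≠ 0`.
      · simp [hS, hL, Real.zero_rpow (div_pos hq0 hp0).ne']
      have hSi := hSpos i l₀ hl₀
      have : ∀ l ∈ L i, ‖β z i l‖ ^ 2 = S i ^ (q / p) / S i * b i l ^ p := fun l hl => by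
        rw [hβ, hz, Real.rpow_def_of_pos hSi, Real.rpow_def_of_pos (hb i l hl),
          ← Real.exp_nat_mul]
        nth_rewrite 4 [← Real.exp_log hSi]
        rw [← Real.exp_sub, ← Real.exp_add]
        congr 1
        push_cast
        field_simp
        ring
      rw [Finset.sum_congr rfl this, ← Finset.mul_sum, div_mul_cancel₀ _ hSi.ne']
  have hθ : ((2 / p : ℝ) : ℂ) ∈ Complex.HadamardThreeLines.verticalClosedStrip 0 1 := by
    refine ⟨?_, ?_⟩
    · simp only [Complex.ofReal_re]; positivity
    · simp only [Complex.ofReal_re]; rwa [div_le_one hp0]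
  have key := Complex.HadamardThreeLines.norm_le_interp_of_mem_verticalClosedStrip' zero_lt_one hθ
    hFd.diffContOnCl hFb hF0 hF1
  have hFθ : F ((2 / p : ℝ) : ℂ) = ∑ j, ∑ i, U i j * ∑ k ∈ K j, ∑ l ∈ L i,
        (a j k : ℂ) * (b i l : ℂ) * (inner ℂ (e j k) (h i l) * inner ℂ (g i l) (f j k)) := by
    have hpC : (p : ℂ) ≠ 0 := Complex.ofReal_ne_zero.2 hp0.ne'
    have hq1 : q * (1 - 1 / p) = 1 := by
      have : 1 - 1 / p = q⁻¹ := by rw [one_div]; linarith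
      rw [this, mul_inv_cancel₀ hq0.ne']
    have hq1C : (q : ℂ) * (1 - 1 / p) = 1 := by exact_mod_cast hq1
    refine Finset.sum_congr rfl fun j _ => Finset.sum_congr rfl fun i _ => ?_
    congr 1
    refine Finset.sum_congr rfl fun k hk => Finset.sum_congr rfl fun l hl => ?_
    congr 2
    · simp only [α]
      have : (q : ℂ) * (1 - ((2 / p : ℝ) : ℂ) / 2) * Real.log (a j k) =
          ((Real.log (a j k) : ℝ) : ℂ) := by
        push_cast
        rw [show (2 / p / 2 : ℂ) = 1 / p by field_simp, hq1C, one_mul]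
      rw [this, ← Complex.ofReal_exp, Real.exp_log (ha j k hk)]
    · simp only [β]
      have : (q / p : ℂ) * (1 - ((2 / p : ℝ) : ℂ) / 2) * Real.log (S i) +
          (p * ((2 / p : ℝ) : ℂ) / 2) * (Real.log (b i l) - Real.log (S i) / p) =
          ((Real.log (b i l) : ℝ) : ℂ) := by
        push_cast
        rw [show (2 / p / 2 : ℂ) = 1 / p by field_simp, show (p * (2 / p) / 2 : ℂ) = 1 by
          field_simp, show (q / p * (1 - 1 / p) : ℂ) = q * (1 - 1 / p) / p by ring, hq1C]
        ring
      rw [this, ← Complex.ofReal_exp, Real.exp_log (hb i l hl)]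
  rw [hFθ] at key
  refine key.trans (le_of_eq ?_)
  have hAN := mul_nonneg hA0 hN0
  simp only [Complex.ofReal_re, sub_zero, div_one]
  have hθ1 : 2 / p ≤ 1 := by rwa [div_le_one hp0]
  -- The exponent of `A * N` is `(1 - 2/p) + (1/2)(2/p) = 1/q`.
  rw [Real.mul_rpow hM hAN, mul_assoc, ← Real.rpow_mul hAN, ← Real.mul_rpow hA0 hN0,
    ← Real.rpow_add_of_nonneg hAN (by linarith) (by positivity)]
  congr 2
  rw [one_div, one_div, ← sub_eq_of_eq_add' hinv.symm]
  ring

end Interpolation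

/-! ### Truncation, duality and the two inequalities -/

section Schatten

variable {H : Type*} [NormedAddCommGroup H] [InnerProductSpace ℂ H]

/-- Lets the truncations of all operators of a family grow simultaneously along one filter. -/
theorem HasSum.tendsto_sum_pi {J α : Type*} [AddCommMonoid α] [TopologicalSpace α]
    {κ : J → Type*} {j : J} {u : κ j → α} {c : α} (hu : HasSum u c) :
    Filter.Tendsto (fun K : ∀ j, Finset (κ j) => ∑ k ∈ K j, u k)
      (Filter.pi fun _ => Filter.atTop) (nhds c) := by
  have hu' : Filter.Tendsto (fun K : Finset (κ j) => ∑ k ∈ K, u k) Filter.atTop (nhds c) := by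
    simpa [HasSum] using hu
  exact hu'.comp (Filter.tendsto_eval_pi _ j)

/-- Evaluates the pairing of `T` with an operator diagonal in the same singular vectors, as the dual
test operators are. -/
theorem inner_apply_of_hasSum {ι : Type*} {σ : ι → ℝ} {e f : ι → H} {T : H →L[ℂ] H}
    (hT : ∀ x, HasSum (fun k => ((σ k : ℂ) * inner ℂ (e k) x) • f k) (T x))
    (he : Orthonormal ℂ e) (hf : Orthonormal ℂ f) (k : ι) :
    inner ℂ (f k) (T (e k)) = σ k := by
  have h1 : T (e k) = (σ k : ℂ) • f k := by
    refine (hT (e k)).unique ?_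
    have := hasSum_single (f := fun l => ((σ l : ℂ) * inner ℂ (e l) (e k)) • f l) k
      (fun l hl => by simp [he.inner_eq_zero hl])
    simpa [he.norm_eq_one] using this
  rw [h1, inner_smul_right, inner_self_eq_norm_sq_to_K, hf.norm_eq_one]
  simp

theorem hasSum_inner_of_hasSum {ι : Type*} {σ : ι → ℝ} {e f : ι → H} {T : H →L[ℂ] H}
    (hT : ∀ x, HasSum (fun k => ((σ k : ℂ) * inner ℂ (e k) x) • f k) (T x)) (x y : H) :
    HasSum (fun k => (σ k : ℂ) * (inner ℂ (e k) x * inner ℂ y (f k))) (inner ℂ y (T x)) := by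
  have := (hT x).mapL (innerSL ℂ y)
  simpa [inner_smul_right, mul_assoc] using this

variable [CompleteSpace H]

theorem MemSchatten.exists_singularValueDecomposition {p : ℝ} {T : H →L[ℂ] H}
    (hT : MemSchatten p T) :
    ∃ (ι : Type) (σ : ι → ℝ) (e f : ι → H), (∀ k, 0 < σ k) ∧ Orthonormal ℂ e ∧ Orthonormal ℂ f ∧
      (∀ x, HasSum (fun k => ((σ k : ℂ) * inner ℂ (e k) x) • f k) (T x)) ∧
      HasSum (fun k => σ k ^ p) (schattenSum p T).toReal := by
  obtain ⟨ι, σ, e, f, hσ, he, hf, hTx, hsum⟩ := hT.1.exists_singularValueDecomposition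
  refine ⟨ι, σ, e, f, hσ, he, hf, hTx, ?_⟩
  have h0 : ∀ k, 0 ≤ σ k ^ p := fun k => Real.rpow_nonneg (hσ k).le p
  have htop := hT.2
  rw [hsum p] at htop ⊢
  have := ENNReal.hasSum_toReal htop
  rw [ENNReal.tsum_toReal_eq fun _ => ENNReal.ofReal_ne_top]
  simpa only [ENNReal.toReal_ofReal (h0 _)] using this

theorem schattenNorm_rpow {p : ℝ} (T : H →L[ℂ] H) (r : ℝ) :
    schattenNorm p T ^ r = (schattenSum p T).toReal ^ (r / p) := by
  rw [schattenNorm, ← Real.rpow_mul ENNReal.toReal_nonneg, one_div_mul_eq_div]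

theorem norm_le_maxEntry {s t : ℕ} (U : Matrix (Fin s) (Fin t) ℂ) (i : Fin s) (j : Fin t) :
    ‖U i j‖ ≤ maxEntry U :=
  le_ciSup (f := fun k : Fin s × Fin t => ‖U k.1 k.2‖) (Set.finite_range _).bddAbove (i, j)

theorem maxEntry_nonneg {s t : ℕ} (U : Matrix (Fin s) (Fin t) ℂ) : 0 ≤ maxEntry U :=
  Real.iSup_nonneg fun _ => norm_nonneg _

theorem IsSubunitary.sum_conj_mul {s t : ℕ} {U : Matrix (Fin s) (Fin t) ℂ} (hU : IsSubunitary U)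
    (j j' : Fin t) : ∑ i, (starRingEnd ℂ) (U i j) * U i j' = if j = j' then 1 else 0 := by
  have hU' : U.conjTranspose * U = 1 := hU
  simpa [Matrix.mul_apply, Matrix.one_apply] using congrFun (congrFun hU' j) j'

/-- A unit column cannot vanish. Positivity is needed to cancel powers of the maximum in the lower
bound. -/
theorem IsSubunitary.maxEntry_pos {s t : ℕ} {U : Matrix (Fin s) (Fin t) ℂ} (hU : IsSubunitary U)
    (j : Fin t) : 0 < maxEntry U := by
  refine lt_of_le_of_ne (maxEntry_nonneg U) fun h => ?_
  have hz : ∀ i, U i j = 0 := fun i => norm_le_zero_iff.1 (h ▸ norm_le_maxEntry U i j)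
  simpa [hz] using hU.sum_conj_mul j j

/-- Closes the duality arguments: the test operators are chosen so that the same `N` appears on both
sides. -/
theorem Real.le_rpow_of_le_mul_rpow {N C p q : ℝ} (hpq : p.HolderConjugate q) (hN : 0 ≤ N)
    (hC : 0 ≤ C) (h : N ≤ C * N ^ (1 / p)) : N ≤ C ^ q := by
  rcases hN.eq_or_lt with rfl | hN
  · exact Real.rpow_nonneg hC _
  have hq := hpq.symm.pos
  have h1 : N ^ (1 / q) ≤ C := by
    have h2 : N ^ (1 / q) * N ^ (1 / p) ≤ C * N ^ (1 / p) := by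
      rwa [← Real.rpow_add hN, one_div q, one_div p, add_comm, hpq.inv_add_inv_eq_one,
        Real.rpow_one, ← one_div]
    exact le_of_mul_le_mul_right h2 (by positivity)
  calc N = (N ^ (1 / q)) ^ q := by
        rw [← Real.rpow_mul hN.le, one_div_mul_cancel hq.ne', Real.rpow_one]
    _ ≤ C ^ q := Real.rpow_le_rpow (by positivity) h1 hq.le

/-- The upper bound, by testing the interpolated pairing on finite truncations of the operators
dual to the `X i`. -/
theorem sum_schattenNorm_rpow_le {s t : ℕ} {U : Matrix (Fin s) (Fin t) ℂ} (hU : IsSubunitary U)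
    {p q : ℝ} (hpq : p.HolderConjugate q) (hp : p ≤ 2)
    {X : Fin s → H →L[ℂ] H} {Y : Fin t → H →L[ℂ] H}
    (hX : ∀ i, MemSchatten p (X i)) (hY : ∀ j, MemSchatten p (Y j))
    (hXY : ∀ i, X i = ∑ j, U i j • Y j) :
    ∑ i, schattenNorm p (X i) ^ q ≤
      maxEntry U ^ (q / p - 1) * (∑ j, schattenNorm p (Y j) ^ p) ^ (q / p) := by
  have hp0 := hpq.pos
  have hq0 := hpq.symm.pos
  have hq2 : 2 ≤ q := by
    rw [hpq.conjugate_eq, le_div_iff₀ hpq.sub_one_pos]; linarith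
  have hqp : q / p = q - 1 := hpq.symm.div_conj_eq_sub_one
  have hpq' : p / q = p - 1 := hpq.div_conj_eq_sub_one
  have hmul : (p - 1) * q = p := hpq.sub_one_mul_conj
  have hM := maxEntry_nonneg U
  choose κ a e f ha he hf hYx hYs using fun j => (hY j).exists_singularValueDecomposition
  choose ι x h g hx hh hg hXx hXs using fun i => (hX i).exists_singularValueDecomposition
  simp only [schattenNorm_rpow, div_self hp0.ne', Real.rpow_one]
  set A : ℝ := ∑ j, (schattenSum p (Y j)).toReal with hA
  have hA0 : 0 ≤ A := Finset.sum_nonneg fun _ _ => ENNReal.toReal_nonneg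
  have hfin : ∀ L : ∀ i, Finset (ι i), ∑ i, (∑ l ∈ L i, x i l ^ p) ^ (q / p) ≤
      maxEntry U ^ (q / p - 1) * A ^ (q / p) := by
    intro L
    set S : Fin s → ℝ := fun i => ∑ l ∈ L i, x i l ^ p with hS
    have hxp : ∀ i l, 0 < x i l ^ p := fun i l => Real.rpow_pos_of_pos (hx i l) p
    have hS0 : ∀ i, 0 ≤ S i := fun i => Finset.sum_nonneg fun l _ => (hxp i l).le
    -- The power `p - 1` gives equality in Hölder for the truncated `X i`; the scalar makes both the
    -- pairing with `X i` and the `p`-th power of the Schatten `q`-norm equal to `S i ^ (q / p)`.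
    let b : ∀ i, ι i → ℝ := fun i l => S i ^ (q / p - 1) * x i l ^ (p - 1)
    have hb : ∀ i, ∀ l ∈ L i, 0 < b i l := fun i l hl =>
      mul_pos (Real.rpow_pos_of_pos (Finset.sum_pos (fun l _ => hxp i l) ⟨l, hl⟩) _)
        (Real.rpow_pos_of_pos (hx i l) _)
    have hbx : ∀ i, ∑ l ∈ L i, b i l * x i l = S i ^ (q / p) := fun i => by
      have h1 : ∀ l, b i l * x i l = S i ^ (q / p - 1) * x i l ^ p := fun l => by
        simp only [b, mul_assoc]
        congr 1
        nth_rewrite 2 [← Real.rpow_one (x i l)]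
        rw [← Real.rpow_add (hx i l), sub_add_cancel]
      simp only [h1, ← Finset.mul_sum]
      change S i ^ (q / p - 1) * S i = _
      rcases (hS0 i).eq_or_lt with h0 | h0
      · rw [← h0, mul_zero, Real.zero_rpow (div_pos hq0 hp0).ne']
      · nth_rewrite 2 [← Real.rpow_one (S i)]
        rw [← Real.rpow_add h0, sub_add_cancel]
    have hbq : ∀ i, (∑ l ∈ L i, b i l ^ q) ^ (p / q) = S i ^ (q / p) := fun i => by
      have h1 : ∀ l, b i l ^ q = (S i ^ (q / p - 1)) ^ q * x i l ^ p := fun l => by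
        simp only [b]
        rw [Real.mul_rpow (Real.rpow_nonneg (hS0 i) _) (Real.rpow_nonneg (hx i l).le _),
          ← Real.rpow_mul (hx i l).le, hmul]
      simp only [h1, ← Finset.mul_sum]
      change ((S i ^ (q / p - 1)) ^ q * S i) ^ (p / q) = _
      rcases (hS0 i).eq_or_lt with h0 | h0
      · rw [← h0, mul_zero, Real.zero_rpow (div_pos hq0 hp0).ne',
          Real.zero_rpow (div_pos hp0 hq0).ne']
      · rw [← Real.rpow_mul h0.le]
        nth_rewrite 2 [← Real.rpow_one (S i)]
        rw [← Real.rpow_add h0, ← Real.rpow_mul h0.le]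
        congr 1
        rw [hpq', hqp]
        linear_combination (q - 2) * hmul + hpq.mul_eq_add
    set N : ℝ := ∑ i, S i ^ (q / p) with hN
    have hN0 : 0 ≤ N := Finset.sum_nonneg fun i _ => Real.rpow_nonneg (hS0 i) _
    have hbound : ∀ K : ∀ j, Finset (κ j), ‖∑ j, ∑ i, U i j * ∑ l ∈ L i, (b i l : ℂ) *
        ∑ k ∈ K j, (a j k : ℂ) * (inner ℂ (e j k) (h i l) * inner ℂ (g i l) (f j k))‖ ≤
        maxEntry U ^ (1 - 2 / q) * A ^ (1 / p) * N ^ (1 / p) := by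
      intro K
      -- The exponents trade roles: here `q ≥ 2`, and the `Y j` lie on the trace-norm side.
      have h1 := norm_pairing_le_of_holderConjugate hU hM (norm_le_maxEntry U) hpq.symm hq2 he hf
        hg hh K L (fun j k _ => ha j k) hb
      simp only [hbq] at h1
      rw [mul_assoc]
      refine le_trans (le_of_eq ?_) (h1.trans ?_)
      · congr 1
        refine Finset.sum_congr rfl fun j _ => Finset.sum_congr rfl fun i _ => ?_
        congr 1
        rw [Finset.sum_comm]
        refine Finset.sum_congr rfl fun l _ => ?_
        rw [Finset.mul_sum]
        exact Finset.sum_congr rfl fun k _ => by ring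
      · gcongr
        · exact Finset.sum_nonneg fun j _ => Finset.sum_nonneg fun k _ =>
            Real.rpow_nonneg (ha j k).le _
        · exact Finset.sum_le_sum fun j _ => sum_le_hasSum _
            (fun k _ => Real.rpow_nonneg (ha j k).le _) (hYs j)
    have hlim : ‖∑ j, ∑ i, U i j * ∑ l ∈ L i, (b i l : ℂ) * inner ℂ (g i l) (Y j (h i l))‖ ≤
        maxEntry U ^ (1 - 2 / q) * A ^ (1 / p) * N ^ (1 / p) := by
      refine le_of_tendsto (x := Filter.pi fun j => (Filter.atTop : Filter (Finset (κ j))))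
        (Filter.Tendsto.norm ?_) (Filter.Eventually.of_forall hbound)
      refine tendsto_finsetSum _ fun j _ => tendsto_finsetSum _ fun i _ =>
        Filter.Tendsto.const_mul _ (tendsto_finsetSum _ fun l _ => Filter.Tendsto.const_mul _ ?_)
      exact (hasSum_inner_of_hasSum (hYx j) (h i l) (g i l)).tendsto_sum_pi
    have hval : ∑ j, ∑ i, U i j * ∑ l ∈ L i, (b i l : ℂ) * inner ℂ (g i l) (Y j (h i l)) =
        (N : ℂ) := by
      rw [Finset.sum_comm, hN, Complex.ofReal_sum]
      refine Finset.sum_congr rfl fun i _ => ?_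
      rw [← hbx i, Complex.ofReal_sum]
      simp only [Finset.mul_sum]
      rw [Finset.sum_comm]
      refine Finset.sum_congr rfl fun l _ => ?_
      rw [Complex.ofReal_mul (b i l), ← inner_apply_of_hasSum (hXx i) (hh i) (hg i) l, hXY i]
      simp only [sum_apply, smul_apply, inner_sum,
        inner_smul_right, Finset.mul_sum]
      exact Finset.sum_congr rfl fun j _ => by ring
    rw [hval, Complex.norm_real, Real.norm_of_nonneg hN0] at hlim
    refine (Real.le_rpow_of_le_mul_rpow hpq hN0 (by positivity) hlim).trans (le_of_eq ?_)
    rw [Real.mul_rpow (by positivity) (by positivity), ← Real.rpow_mul hM, ← Real.rpow_mul hA0,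
      hqp]
    congr 2
    -- `(1 - 2/q) q = q - 2 = q/p - 1`.
    · field_simp; ring
    · rw [one_div_mul_eq_div, hqp]
  refine le_of_tendsto (x := Filter.pi fun i => (Filter.atTop : Filter (Finset (ι i))))
    (tendsto_finsetSum _ fun i _ => ?_) (Filter.Eventually.of_forall hfin)
  exact (hXs i).tendsto_sum_pi.rpow_const (Or.inr (div_pos hq0 hp0).le)

/-- The lower bound, by testing the interpolated pairing on finite truncations of the operators
dual to the `Y j`. -/
theorem le_sum_schattenNorm_rpow {s t : ℕ} {U : Matrix (Fin s) (Fin t) ℂ} (hU : IsSubunitary U)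
    {p q : ℝ} (hpq : p.HolderConjugate q) (hp : 2 ≤ p)
    {X : Fin s → H →L[ℂ] H} {Y : Fin t → H →L[ℂ] H}
    (hX : ∀ i, MemSchatten p (X i)) (hY : ∀ j, MemSchatten p (Y j))
    (hXY : ∀ i, X i = ∑ j, (starRingEnd ℂ) (U i j) • Y j) :
    maxEntry U ^ (q / p - 1) * (∑ j, schattenNorm p (Y j) ^ p) ^ (q / p) ≤
      ∑ i, schattenNorm p (X i) ^ q := by
  have hp0 := hpq.pos
  have hq0 := hpq.symm.pos
  have hqp : q / p = q - 1 := hpq.symm.div_conj_eq_sub_one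
  have hmul : (p - 1) * q = p := hpq.sub_one_mul_conj
  have hM := maxEntry_nonneg U
  have hYX : ∀ j, Y j = ∑ i, U i j • X i := fun j => by
    simp only [hXY, Finset.smul_sum, smul_smul]
    rw [Finset.sum_comm]
    simp only [mul_comm (U _ _), ← Finset.sum_smul, hU.sum_conj_mul]
    simp
  choose κ y e f hy he hf hYx hYs using fun j => (hY j).exists_singularValueDecomposition
  choose ι b g h hb hg hh hXx hXs using fun i => (hX i).exists_singularValueDecomposition
  simp only [schattenNorm_rpow, div_self hp0.ne', Real.rpow_one]
  -- Without columns `maxEntry U` is `0`, but the left side vanishes through its other factor.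
  rcases isEmpty_or_nonempty (Fin t) with ht | ⟨⟨j₀⟩⟩
  · rw [Finset.univ_eq_empty, Finset.sum_empty, Real.zero_rpow (div_pos hq0 hp0).ne', mul_zero]
    exact Finset.sum_nonneg fun i _ => Real.rpow_nonneg ENNReal.toReal_nonneg _
  have hMpos := hU.maxEntry_pos j₀
  set D : ℝ := ∑ i, (schattenSum p (X i)).toReal ^ (q / p) with hD
  have hD0 : 0 ≤ D := Finset.sum_nonneg fun _ _ => Real.rpow_nonneg ENNReal.toReal_nonneg _
  have hfin : ∀ K : ∀ j, Finset (κ j),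
      maxEntry U ^ (q / p - 1) * (∑ j, ∑ k ∈ K j, y j k ^ p) ^ (q / p) ≤ D := by
    intro K
    set N : ℝ := ∑ j, ∑ k ∈ K j, y j k ^ p with hN
    have hN0 : 0 ≤ N := Finset.sum_nonneg fun j _ => Finset.sum_nonneg fun k _ =>
      Real.rpow_nonneg (hy j k).le _
    -- No scalar is needed now: the pairing with `Y j` and the `q`-th power sum are both `∑ y^p`.
    let a : ∀ j, κ j → ℝ := fun j k => y j k ^ (p - 1)
    have haq : ∀ j k, a j k ^ q = y j k ^ p := fun j k => by
      rw [← Real.rpow_mul (hy j k).le, hmul]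
    have hay : ∀ j k, a j k * y j k = y j k ^ p := fun j k => by
      simp only [a]
      nth_rewrite 2 [← Real.rpow_one (y j k)]
      rw [← Real.rpow_add (hy j k), sub_add_cancel]
    have hbound : ∀ L : ∀ i, Finset (ι i), ‖∑ j, ∑ i, U i j * ∑ k ∈ K j, (a j k : ℂ) *
        ∑ l ∈ L i, (b i l : ℂ) * (inner ℂ (g i l) (e j k) * inner ℂ (f j k) (h i l))‖ ≤
        maxEntry U ^ (1 - 2 / p) * D ^ (1 / q) * N ^ (1 / q) := by
      intro L
      have h1 := norm_pairing_le_of_holderConjugate hU hM (norm_le_maxEntry U) hpq hp hf he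
        hg hh K L (fun j k _ => Real.rpow_pos_of_pos (hy j k) (p - 1)) (fun i l _ => hb i l)
      rw [mul_assoc, mul_comm (D ^ _)]
      refine le_trans (le_of_eq ?_) (h1.trans ?_)
      · congr 1
        refine Finset.sum_congr rfl fun j _ => Finset.sum_congr rfl fun i _ => ?_
        congr 1
        refine Finset.sum_congr rfl fun k _ => ?_
        rw [Finset.mul_sum]
        exact Finset.sum_congr rfl fun l _ => by ring
      · simp only [a] at haq
        simp only [haq]
        have hS0 : ∀ i, 0 ≤ ∑ l ∈ L i, b i l ^ p := fun i =>
          Finset.sum_nonneg fun l _ => Real.rpow_nonneg (hb i l).le _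
        gcongr
        · exact Finset.sum_nonneg fun i _ => Real.rpow_nonneg (hS0 i) _
        · refine Finset.sum_le_sum fun i _ => Real.rpow_le_rpow (hS0 i) (sum_le_hasSum _
            (fun l _ => Real.rpow_nonneg (hb i l).le _) (hXs i)) (div_pos hq0 hp0).le
    have hlim : ‖∑ j, ∑ i, U i j * ∑ k ∈ K j, (a j k : ℂ) * inner ℂ (f j k) (X i (e j k))‖ ≤
        maxEntry U ^ (1 - 2 / p) * D ^ (1 / q) * N ^ (1 / q) := by
      refine le_of_tendsto (x := Filter.pi fun i => (Filter.atTop : Filter (Finset (ι i))))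
        (Filter.Tendsto.norm ?_) (Filter.Eventually.of_forall hbound)
      refine tendsto_finsetSum _ fun j _ => tendsto_finsetSum _ fun i _ =>
        Filter.Tendsto.const_mul _ (tendsto_finsetSum _ fun l _ => Filter.Tendsto.const_mul _ ?_)
      exact (hasSum_inner_of_hasSum (hXx i) (e j l) (f j l)).tendsto_sum_pi
    have hval : ∑ j, ∑ i, U i j * ∑ k ∈ K j, (a j k : ℂ) * inner ℂ (f j k) (X i (e j k)) =
        (N : ℂ) := by
      rw [hN, Complex.ofReal_sum]
      refine Finset.sum_congr rfl fun j _ => ?_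
      rw [Complex.ofReal_sum]
      simp only [Finset.mul_sum]
      rw [Finset.sum_comm]
      refine Finset.sum_congr rfl fun k _ => ?_
      rw [← hay, Complex.ofReal_mul, ← inner_apply_of_hasSum (hYx j) (he j) (hf j) k, hYX j]
      simp only [sum_apply, smul_apply, inner_sum,
        inner_smul_right, Finset.mul_sum]
      exact Finset.sum_congr rfl fun i _ => by ring
    rw [hval, Complex.norm_real, Real.norm_of_nonneg hN0] at hlim
    have hNp := Real.le_rpow_of_le_mul_rpow hpq.symm hN0 (by positivity) hlim
    have hNq := Real.rpow_le_rpow hN0 hNp (div_pos hq0 hp0).le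
    rw [← Real.rpow_mul (by positivity), mul_div_cancel₀ q hp0.ne',
      Real.mul_rpow (by positivity) (by positivity), ← Real.rpow_mul hM, ← Real.rpow_mul hD0,
      one_div_mul_cancel hq0.ne', Real.rpow_one] at hNq
    calc maxEntry U ^ (q / p - 1) * N ^ (q / p)
        ≤ maxEntry U ^ (q / p - 1) * (maxEntry U ^ ((1 - 2 / p) * q) * D) := by gcongr
      _ = D := by
        rw [← mul_assoc, ← Real.rpow_add hMpos]
        -- Since `q/p = q - 1`, the summands are `q - 2` and `2 - q`.
        have : q / p - 1 + (1 - 2 / p) * q = 0 := by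
          linear_combination (-1) * hqp
        rw [this, Real.rpow_zero, one_mul]
  refine le_of_tendsto (x := Filter.pi fun j => (Filter.atTop : Filter (Finset (κ j))))
    (Filter.Tendsto.const_mul _ (Filter.Tendsto.rpow_const
      (tendsto_finsetSum _ fun j _ => ?_) (Or.inr (div_pos hq0 hp0).le)))
    (Filter.Eventually.of_forall hfin)
  exact (hYs j).tendsto_sum_pi

end Schatten

theorem theorem1p9 {H : Type*} [NormedAddCommGroup H] [InnerProductSpace ℂ H] [CompleteSpace H]
    {s t : ℕ} (U : Matrix (Fin s) (Fin t) ℂ) (hU : IsSubunitary U)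
    (p q : ℝ) (hpq : p.HolderConjugate q)
    (X : Fin s → H →L[ℂ] H) (Y : Fin t → H →L[ℂ] H)
    (hX : ∀ i, MemSchatten p (X i)) (hY : ∀ j, MemSchatten p (Y j)) :
    (p ≤ 2 → (∀ i, X i = ∑ j, U i j • Y j) →
      ∑ i, schattenNorm p (X i) ^ q ≤
        maxEntry U ^ (q / p - 1) * (∑ j, schattenNorm p (Y j) ^ p) ^ (q / p)) ∧
    (2 ≤ p → (∀ i, X i = ∑ j, (starRingEnd ℂ) (U i j) • Y j) →
      maxEntry U ^ (q / p - 1) * (∑ j, schattenNorm p (Y j) ^ p) ^ (q / p) ≤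
        ∑ i, schattenNorm p (X i) ^ q) :=
  ⟨fun hp hXY => sum_schattenNorm_rpow_le hU hpq hp hX hY hXY,
    fun hp hXY => le_sum_schattenNorm_rpow hU hpq hp hX hY hXY⟩
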